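/- **Setting.** Let $n,m,p\in\mathbb N$ and let $\mathcal I$ be the set of closed bounded intervals $Q=[\underline q,\overline q]\subset\mathbb R$, $\underline q\le\overline q$. Put $q^c=\frac{\underline q+\overline q}{2}$, $q^w=\frac{\overline q-\underline q}{2}$, and write $Q\prec_{CW}R$ if $q^c<r^c$ and $q^w<r^w$. Let $F_1,\dots,F_m:\mathbb R^n\to\mathcal I$, $F_k=[\underline F_k,\overline F_k]$, and $g_1,\dots,g_p:\mathbb R^n\to\mathbb R$ be locally Lipschitz continuous, where for $F_k$ this means that every point of $\mathbb R^n$ has a neighbourhood $U$ and a constant $L>0$ with $\max\{|\underline F_k(u)-\underline F_k(u')|,|\overline F_k(u)-\overline F_k(u')|\}\le L\|u-u'\|$ for all $u,u'\in U$ ($\|\cdot\|$ is the Euclidean norm). Let $S=\{u\in\mathbb R^n: g_j(u)\le 0,\ j=1,\dots,p\}$. For a locally Lipschitz $\psi:\mathbb R^n\to\mathbb R$ let $$\psi^0(z;w)=\limsup_{u\to z,\,t\to0^+}\frac{\psi(u+tw)-\psi(u)}{t},\qquad \partial^0\psi(z)=\{z^*\in\mathbb R^n:\langle z^*,w\rangle\le\psi^0(z;w)\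 \ \forall w\in\mathbb R^n\}$$ be the Clarke directional derivative and the Clarke generalized gradient, and let $\partial^0F_k(z)=\mathrm{co}\,\big(\partial^0F_k^c(z)\cup\partial^0F_k^w(z)\big)$, where $F_k^c=\frac{\underline F_k+\overline F_k}{2}$, $F_k^w=\frac{\overline F_k-\underline F_k}{2}$. A point $\bar u\in S$ is a *locally weak minimal solution* of minimizing $F=(F_1,\dots,F_m)$ over $S$ if it has a neighbourhood $U$ such that there is no $z\in S\cap U$ with $F_k(z)\prec_{CW}F_k(\bar u)$ for all $k$. The *basic constraint qualification* (BCQ) holds at $u\in S$ if there is no $\mu\in\mathbb R^p_+\setminus\{0\}$ with $\mu_j=0$ whenever $g_j(u)\ne0$ such that $0\in\sum_{j=1}^p\mu_j\,\partial^0g_j(u)$. **Theorem 4.4.** Let $\bar u\in S$ be a locally weak minimal solution, and suppose that $\bar u$ has a neighbourhood $V$ such that BCQ holds at every point of $S\cap V$. Let $\epsilon_i>0$ for $i=1,2,\dots$ with $\epsilon_i\to0$. Then every sequence $(x_i)$ in $S$ with $x_i\to\bar u$ has a subsequence $(z_i)$ such that for every $i$ there is $y_i\in S$ with (i) $\|z_i-y_i\|\le\sqrt{\epsilon_i}$;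 (ii) there exist $\lambda^i\in\mathbb R^m_+$ with $\sum_{k=1}^m\lambda^i_k=1$, $\mu^i\in\mathbb R^p_+$, $u^i_k\in\partial^0F_k(y_i)$ for $k=1,\dots,m$ and $v^i_j\in\partial^0g_j(y_i)$ for $j=1,\dots,p$ such that $$\Big\|\sum_{k=1}^m\lambda^i_ku^i_k+\sum_{j=1}^p\mu^i_jv^i_j\Big\|\le\sqrt{\epsilon_i},\qquad \sum_{j=1}^p\mu^i_jg_j(y_i)=0.$$ -/

import Mathlib

open scoped Topology Pointwise

noncomputable section

namespace MIOP

/-- The center `(q₁ + q₂) / 2` of a closed bounded interval `[q₁, q₂]`. -/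
def center (Q : NonemptyInterval ℝ) : ℝ := (Q.fst + Q.snd) / 2

/-- The (half-)width `(q₂ - q₁) / 2` of a closed bounded interval `[q₁, q₂]`. -/
def width (Q : NonemptyInterval ℝ) : ℝ := (Q.snd - Q.fst) / 2

/-- The strict center-width order on intervals. -/
def LTCW (Q R : NonemptyInterval ℝ) : Prop :=
  center Q < center R ∧ width Q < width R

/-- The norm `max {|q₁|, |q₂|}` of an interval `[q₁, q₂]`. -/
def intervalNorm (Q : NonemptyInterval ℝ) : ℝ := max |Q.fst| |Q.snd|

/-- The generalized Hukuhara difference of two intervals. -/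
def gHDiff (Q R : NonemptyInterval ℝ) : NonemptyInterval ℝ where
  fst := min (Q.fst - R.fst) (Q.snd - R.snd)
  snd := max (Q.fst - R.fst) (Q.snd - R.snd)
  fst_le_snd := min_le_max

/-- The defining property of the generalized Hukuhara difference. -/
theorem gHDiff_eq_iff (Q R P : NonemptyInterval ℝ) :
    gHDiff Q R = P ↔ Q = R + P ∨ R = Q - P := by
  have h1 := Q.fst_le_snd
  have h2 := R.fst_le_snd
  have h3 := P.fst_le_snd
  simp only [NonemptyInterval.ext_iff, Prod.ext_iff, gHDiff, NonemptyInterval.fst_add,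
    NonemptyInterval.snd_add, NonemptyInterval.fst_sub, NonemptyInterval.snd_sub]
  rcases le_total (Q.fst - R.fst) (Q.snd - R.snd) with h | h
  · simp only [min_eq_left h, max_eq_right h]
    grind
  · simp only [min_eq_right h, max_eq_left h]
    grind

variable {n m p : ℕ}

/-- Local Lipschitz continuity of an interval-valued function on `ℝⁿ`. -/
def LocallyLipschitzIVF (f : EuclideanSpace ℝ (Fin n) → NonemptyInterval ℝ) : Prop :=
  ∀ u₀, ∃ U ∈ 𝓝 u₀, ∃ L : ℝ, 0 < L ∧
    ∀ u₁ ∈ U, ∀ u₂ ∈ U, intervalNorm (gHDiff (f u₁) (f u₂)) ≤ L * ‖u₁ - u₂‖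

/-- The Clarke directional derivative `ψ⁰(z; w)` of a locally Lipschitz function `ψ`: the upper
limit of `(ψ (u + t w) - ψ u) / t` as `u → z` and `t → 0⁺`. -/
def clarkeDeriv (ψ : EuclideanSpace ℝ (Fin n) → ℝ) (z w : EuclideanSpace ℝ (Fin n)) : ℝ :=
  Filter.limsup (fun q : EuclideanSpace ℝ (Fin n) × ℝ => (ψ (q.1 + q.2 • w) - ψ q.1) / q.2)
    (𝓝 z ×ˢ 𝓝[>] (0 : ℝ))

/-- The Clarke generalized gradient `∂⁰ψ(z)` of a locally Lipschitz function `ψ`. -/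
def clarkeGrad (ψ : EuclideanSpace ℝ (Fin n) → ℝ) (z : EuclideanSpace ℝ (Fin n)) :
    Set (EuclideanSpace ℝ (Fin n)) :=
  {s | ∀ w, inner ℝ s w ≤ clarkeDeriv ψ z w}

/-- The weakly generalized gradient of a locally Lipschitz interval-valued function: the convex
hull of the Clarke generalized gradients of its center and of its width. -/
def weakGrad (f : EuclideanSpace ℝ (Fin n) → NonemptyInterval ℝ) (z : EuclideanSpace ℝ (Fin n)) :
    Set (EuclideanSpace ℝ (Fin n)) :=
  convexHull ℝ (clarkeGrad (fun u => center (f u)) z ∪ clarkeGrad (fun u => width (f u)) z)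

/-- The feasible set `S = {u | g_j(u) ≤ 0 for all j}`. -/
def feasible (g : Fin p → EuclideanSpace ℝ (Fin n) → ℝ) : Set (EuclideanSpace ℝ (Fin n)) :=
  {u | ∀ j, g j u ≤ 0}

/-- `z₀` is a locally weak minimal solution of minimizing `F = (F_1, …, F_m)` over `S`. -/
def IsLocallyWeakMinimal (F : Fin m → EuclideanSpace ℝ (Fin n) → NonemptyInterval ℝ)
    (S : Set (EuclideanSpace ℝ (Fin n))) (z₀ : EuclideanSpace ℝ (Fin n)) : Prop :=
  z₀ ∈ S ∧ ∃ U ∈ 𝓝 z₀, ¬ ∃ z ∈ S ∩ U, ∀ k, LTCW (F k z) (F k z₀)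

/-- The basic constraint qualification at the (feasible) point `u`: there is no nonzero
`μ ∈ ℝ^p_+`, vanishing off the active indices, with `0 ∈ ∑ j, μ_j ∂⁰g_j(u)`
(a Minkowski sum of sets). -/
def BCQ (g : Fin p → EuclideanSpace ℝ (Fin n) → ℝ) (u : EuclideanSpace ℝ (Fin n)) : Prop :=
  ¬ ∃ μ : Fin p → ℝ, μ ≠ 0 ∧ (∀ j, 0 ≤ μ j) ∧ (∀ j, g j u ≠ 0 → μ j = 0) ∧
    (0 : EuclideanSpace ℝ (Fin n)) ∈ ∑ j, μ j • clarkeGrad (g j) u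

end MIOP

end

/-! The limit point itself serves as every `y_i`: an exact KKT condition holds at `ubar`, so the
residual is zero, and convergence of `x` yields a subsequence within the prescribed distances. KKT
comes from a Fritz John rule. The order asks center and width both to decrease, so no direction can
have negative Clarke derivative for all centers, widths and active constraints at once. As these
derivatives are attained support functions (`exists_mem_clarkeGrad_inner_eq`), separation
(`exists_convexCombination_eq_zero`) puts 0 among the convex combinations of the gradients. BCQ at
`ubar` makes the total objective weight positive, which permits normalization. -/

namespace MIOP

/-! ### Clarke derivatives and gradients -/

section ClarkeCalculus

variable {n : ℕ} {ψ : EuclideanSpace ℝ (Fin n) → ℝ}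

theorem tendsto_add_smul (z w : EuclideanSpace ℝ (Fin n)) :
    Filter.Tendsto (fun q : EuclideanSpace ℝ (Fin n) × ℝ => q.1 + q.2 • w)
      (𝓝 z ×ˢ 𝓝[>] (0 : ℝ)) (𝓝 z) := by
  have hc : Continuous fun q : EuclideanSpace ℝ (Fin n) × ℝ => q.1 + q.2 • w := by fun_prop
  have h := hc.tendsto (z, 0)
  rw [nhds_prod_eq] at h
  simp only [zero_smul, add_zero] at h
  exact h.mono_left (Filter.prod_mono le_rfl nhdsWithin_le_nhds)

theorem eventually_snd_pos (z : EuclideanSpace ℝ (Fin n)) :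
    ∀ᶠ q in 𝓝 z ×ˢ 𝓝[>] (0 : ℝ), 0 < q.2 :=
  Filter.tendsto_snd.eventually self_mem_nhdsWithin

/-- Supplies the boundedness without which a real-valued `limsup` may be a junk value. -/
theorem exists_abs_quotient_le (hψ : LocallyLipschitz ψ) (z : EuclideanSpace ℝ (Fin n)) :
    ∃ L : ℝ, 0 ≤ L ∧ ∀ w, ∀ᶠ q in 𝓝 z ×ˢ 𝓝[>] (0 : ℝ),
      |(ψ (q.1 + q.2 • w) - ψ q.1) / q.2| ≤ L * ‖w‖ := by
  obtain ⟨K, t, ht, hL⟩ := hψ z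
  refine ⟨K, K.2, fun w => ?_⟩
  filter_upwards [(tendsto_add_smul z w).eventually ht, Filter.tendsto_fst.eventually ht,
    eventually_snd_pos z] with q h1 h2 h3
  have h := hL.dist_le_mul _ h1 _ h2
  rw [Real.dist_eq, dist_eq_norm, add_sub_cancel_left, norm_smul, Real.norm_of_nonneg h3.le] at h
  rw [abs_div, abs_of_pos h3, div_le_iff₀ h3]
  linarith

theorem clarkeDeriv_le (hψ : LocallyLipschitz ψ) {z w : EuclideanSpace ℝ (Fin n)} {c : ℝ}
    (h : ∀ᶠ q in 𝓝 z ×ˢ 𝓝[>] (0 : ℝ), (ψ (q.1 + q.2 • w) - ψ q.1) / q.2 ≤ c) :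
    clarkeDeriv ψ z w ≤ c := by
  obtain ⟨L, -, hL⟩ := exists_abs_quotient_le hψ z
  exact Filter.limsup_le_of_le (Filter.IsCoboundedUnder.of_frequently_ge
    ((hL w).mono fun q hq => (abs_le.1 hq).1).frequently) h

theorem eventually_quotient_lt (hψ : LocallyLipschitz ψ) {z w : EuclideanSpace ℝ (Fin n)} {c : ℝ}
    (h : clarkeDeriv ψ z w < c) :
    ∀ᶠ q in 𝓝 z ×ˢ 𝓝[>] (0 : ℝ), (ψ (q.1 + q.2 • w) - ψ q.1) / q.2 < c := by
  obtain ⟨L, -, hL⟩ := exists_abs_quotient_le hψ z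
  exact Filter.eventually_lt_of_limsup_lt h
    ⟨L * ‖w‖, Filter.eventually_map.2 ((hL w).mono fun q hq => (abs_le.1 hq).2)⟩

theorem exists_clarkeDeriv_le_mul_norm (hψ : LocallyLipschitz ψ)
    (z : EuclideanSpace ℝ (Fin n)) : ∃ L : ℝ, 0 ≤ L ∧ ∀ w, clarkeDeriv ψ z w ≤ L * ‖w‖ := by
  obtain ⟨L, h0, hL⟩ := exists_abs_quotient_le hψ z
  exact ⟨L, h0, fun w => clarkeDeriv_le hψ ((hL w).mono fun q hq => (abs_le.1 hq).2)⟩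

/-- The quotient splits at `u + t v`, which also tends to `z`; this is where the moving base point
matters. -/
theorem clarkeDeriv_add_le (hψ : LocallyLipschitz ψ) (z v w : EuclideanSpace ℝ (Fin n)) :
    clarkeDeriv ψ z (v + w) ≤ clarkeDeriv ψ z v + clarkeDeriv ψ z w := by
  refine le_of_forall_pos_le_add fun δ hδ => clarkeDeriv_le hψ ?_
  have hv := eventually_quotient_lt hψ (lt_add_of_pos_right (clarkeDeriv ψ z v) (half_pos hδ))
  have hw := eventually_quotient_lt hψ (lt_add_of_pos_right (clarkeDeriv ψ z w) (half_pos hδ))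
  filter_upwards [hv, ((tendsto_add_smul z v).prodMk Filter.tendsto_snd).eventually hw]
    with q h1 h2
  have h3 : q.1 + q.2 • (v + w) = q.1 + q.2 • v + q.2 • w := by rw [smul_add, add_assoc]
  rw [h3, ← sub_add_sub_cancel _ (ψ (q.1 + q.2 • v)), add_div]
  linarith

theorem clarkeDeriv_smul_le (hψ : LocallyLipschitz ψ) (z w : EuclideanSpace ℝ (Fin n)) {c : ℝ}
    (hc : 0 < c) : clarkeDeriv ψ z (c • w) ≤ c * clarkeDeriv ψ z w := by
  refine le_of_forall_pos_le_add fun δ hδ => clarkeDeriv_le hψ ?_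
  have hw := eventually_quotient_lt hψ (lt_add_of_pos_right (clarkeDeriv ψ z w) (div_pos hδ hc))
  have ht : Filter.Tendsto (fun t : ℝ => t * c) (𝓝[>] 0) (𝓝[>] 0) := by
    refine tendsto_nhdsWithin_iff.2 ⟨?_, ?_⟩
    · simpa using ((continuous_mul_const c).tendsto 0).mono_left nhdsWithin_le_nhds
    · filter_upwards [self_mem_nhdsWithin] with t ht using mul_pos ht hc
  filter_upwards [(Filter.tendsto_id.prodMap ht).eventually hw, eventually_snd_pos z] with q h1 h2
  simp only [Prod.map_fst, Prod.map_snd, id_eq, mul_smul] at h1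
  rw [← div_div, div_lt_iff₀ hc, add_mul, div_mul_cancel₀ _ hc.ne', mul_comm _ c] at h1
  exact h1.le

theorem clarkeDeriv_smul (hψ : LocallyLipschitz ψ) (z w : EuclideanSpace ℝ (Fin n)) {c : ℝ}
    (hc : 0 < c) : clarkeDeriv ψ z (c • w) = c * clarkeDeriv ψ z w := by
  refine (clarkeDeriv_smul_le hψ z w hc).antisymm ?_
  have h := clarkeDeriv_smul_le hψ z (c • w) (inv_pos.2 hc)
  rw [inv_smul_smul₀ hc.ne'] at h
  rwa [le_inv_mul_iff₀ hc] at h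

theorem clarkeDeriv_zero_nonneg (hψ : LocallyLipschitz ψ) (z : EuclideanSpace ℝ (Fin n)) :
    0 ≤ clarkeDeriv ψ z 0 := by
  simpa using clarkeDeriv_add_le hψ z 0 0

/-- The Clarke directional derivative is the support function of the generalized gradient, and
the supremum is attained. -/
theorem exists_mem_clarkeGrad_inner_eq (hψ : LocallyLipschitz ψ)
    (z w : EuclideanSpace ℝ (Fin n)) : ∃ s ∈ clarkeGrad ψ z, inner ℝ s w = clarkeDeriv ψ z w := by
  have h0 := clarkeDeriv_zero_nonneg hψ z
  have hz : clarkeDeriv ψ z 0 = 0 := by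
    obtain ⟨L, -, hL⟩ := exists_clarkeDeriv_le_mul_norm hψ z
    exact le_antisymm (by simpa using hL 0) h0
  -- Makes `c • w ↦ c * ψ⁰(z; w)` well defined even when `w = 0`; Hahn-Banach extends it below.
  have hw : ∀ c : ℝ, c • w = 0 → c • clarkeDeriv ψ z w = 0 := by
    intro c hc
    rcases smul_eq_zero.1 hc with rfl | rfl
    · simp
    · simp [hz]
  obtain ⟨f, hf, hle⟩ := exists_extension_of_le_sublinear
    (LinearPMap.mkSpanSingleton' w (clarkeDeriv ψ z w) hw) (clarkeDeriv ψ z)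
    (fun c hc x => clarkeDeriv_smul hψ z x hc) (clarkeDeriv_add_le hψ z) (by
      rintro ⟨x, hx⟩
      obtain ⟨c, rfl⟩ := Submodule.mem_span_singleton.1 hx
      rw [LinearPMap.mkSpanSingleton'_apply, smul_eq_mul]
      rcases lt_trichotomy c 0 with hc | rfl | hc
      -- For negative `c`, use `0 ≤ ψ⁰(c w) + ψ⁰(-c w)` and homogeneity for `-c`.
      · have h1 := clarkeDeriv_add_le hψ z (c • w) ((-c) • w)
        rw [clarkeDeriv_smul hψ z w (neg_pos.2 hc), ← add_smul, add_neg_cancel, zero_smul] at h1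
        simp only [RingHom.id_apply] at h1 ⊢
        linarith
      · simpa using h0
      · exact (clarkeDeriv_smul hψ z w hc).ge)
  refine ⟨(InnerProductSpace.toDual ℝ _).symm (LinearMap.toContinuousLinearMap f),
    fun v => ?_, ?_⟩
  · rw [InnerProductSpace.toDual_symm_apply]
    exact hle v
  · rw [InnerProductSpace.toDual_symm_apply]
    exact (hf ⟨w, Submodule.mem_span_singleton_self w⟩).trans
      (LinearPMap.mkSpanSingleton'_apply_self w _ hw _)

theorem clarkeGrad_nonempty (hψ : LocallyLipschitz ψ) (z : EuclideanSpace ℝ (Fin n)) :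
    (clarkeGrad ψ z).Nonempty :=
  let ⟨s, hs, _⟩ := exists_mem_clarkeGrad_inner_eq hψ z 0
  ⟨s, hs⟩

theorem convex_clarkeGrad (ψ : EuclideanSpace ℝ (Fin n) → ℝ) (z : EuclideanSpace ℝ (Fin n)) :
    Convex ℝ (clarkeGrad ψ z) := by
  intro s hs t ht a b ha hb hab w
  rw [inner_add_left, real_inner_smul_left, real_inner_smul_left]
  calc a * inner ℝ s w + b * inner ℝ t w
      ≤ a * clarkeDeriv ψ z w + b * clarkeDeriv ψ z w :=
        add_le_add (mul_le_mul_of_nonneg_left (hs w) ha) (mul_le_mul_of_nonneg_left (ht w) hb)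
    _ = clarkeDeriv ψ z w := by rw [← add_mul, hab, one_mul]

theorem isCompact_clarkeGrad (hψ : LocallyLipschitz ψ) (z : EuclideanSpace ℝ (Fin n)) :
    IsCompact (clarkeGrad ψ z) := by
  obtain ⟨L, h0, hL⟩ := exists_clarkeDeriv_le_mul_norm hψ z
  have hclosed : IsClosed (clarkeGrad ψ z) := by
    have h : clarkeGrad ψ z = ⋂ w, {s | inner ℝ s w ≤ clarkeDeriv ψ z w} := by
      ext s
      simp [clarkeGrad]
    rw [h]
    exact isClosed_iInter fun w => isClosed_le (by fun_prop) continuous_const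
  refine Metric.isCompact_of_isClosed_isBounded hclosed
    ((Metric.isBounded_closedBall (x := 0) (r := L)).subset fun s hs => ?_)
  rw [mem_closedBall_zero_iff]
  -- Testing `s` against itself gives `‖s‖² ≤ L ‖s‖`.
  have h := (hs s).trans (hL s)
  rw [real_inner_self_eq_norm_mul_norm] at h
  rcases (norm_nonneg s).eq_or_lt with hs0 | hs0
  · rwa [← hs0]
  · exact le_of_mul_le_mul_right h hs0

theorem eventually_lt_of_clarkeDeriv_neg (hψ : LocallyLipschitz ψ)
    {z w : EuclideanSpace ℝ (Fin n)} (h : clarkeDeriv ψ z w < 0) :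
    ∀ᶠ t in 𝓝[>] (0 : ℝ), ψ (z + t • w) < ψ z := by
  have ht : Filter.Tendsto (fun t : ℝ => (z, t)) (𝓝[>] 0) (𝓝 z ×ˢ 𝓝[>] (0 : ℝ)) :=
    tendsto_const_nhds.prodMk Filter.tendsto_id
  filter_upwards [ht.eventually (eventually_quotient_lt hψ h), self_mem_nhdsWithin] with t h1 h2
  have h3 := (div_lt_iff₀ (Set.mem_Ioi.1 h2)).1 h1
  simp only [zero_mul] at h3
  exact sub_neg.1 h3

end ClarkeCalculus

/-! ### A theorem of the alternative -/

section Alternative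

variable {ι E : Type*} [Fintype ι] [NormedAddCommGroup E] [InnerProductSpace ℝ E]

/-- Weights mix linearly, and for each `i` the two weighted points of `A i` merge into one point
carrying the summed weight. -/
theorem convex_convexCombinations {A : ι → Set E} (hconv : ∀ i, Convex ℝ (A i)) :
    Convex ℝ ((fun q : (ι → ℝ) × (ι → E) => ∑ i, q.1 i • q.2 i) ''
      (stdSimplex ℝ ι ×ˢ Set.univ.pi A)) := by
  rintro _ ⟨⟨l, a⟩, ⟨hl, ha⟩, rfl⟩ _ ⟨⟨l', a'⟩, ⟨hl', ha'⟩, rfl⟩ s t hs ht hst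
  choose c hc hceq using fun i => (hconv i).exists_mem_add_smul_eq (ha i trivial) (ha' i trivial)
    (mul_nonneg hs (hl.1 i)) (mul_nonneg ht (hl'.1 i))
  refine ⟨(s • l + t • l', c), ⟨convex_stdSimplex ℝ ι hl hl' hs ht hst, fun i _ => hc i⟩, ?_⟩
  simp only [Pi.add_apply, Pi.smul_apply, smul_eq_mul, hceq, Finset.sum_add_distrib, mul_smul,
    Finset.smul_sum]

/-- A theorem of the alternative for finitely many convex compact sets: if every direction makes
a nonnegative inner product with a point of one of the sets, then the origin is a convex
combination of points of the sets. -/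
theorem exists_convexCombination_eq_zero [CompleteSpace E] {A : ι → Set E}
    (hconv : ∀ i, Convex ℝ (A i)) (hcomp : ∀ i, IsCompact (A i)) (hne : ∀ i, (A i).Nonempty)
    (h : ∀ w : E, ∃ i, ∃ s ∈ A i, 0 ≤ inner ℝ s w) :
    ∃ l ∈ stdSimplex ℝ ι, ∃ a : ι → E, (∀ i, a i ∈ A i) ∧ ∑ i, l i • a i = 0 := by
  classical
  by_contra hcon
  have h0 : (0 : E) ∉ (fun q : (ι → ℝ) × (ι → E) => ∑ i, q.1 i • q.2 i) ''
      (stdSimplex ℝ ι ×ˢ Set.univ.pi A) := by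
    rintro ⟨⟨l, a⟩, ⟨hl, ha⟩, hla⟩
    exact hcon ⟨l, hl, a, fun i => ha i trivial, hla⟩
  have hK := ((isCompact_stdSimplex ℝ ι).prod (isCompact_univ_pi hcomp)).image
    (f := fun q : (ι → ℝ) × (ι → E) => ∑ i, q.1 i • q.2 i) (by fun_prop)
  obtain ⟨f, u, hu, hf⟩ := geometric_hahn_banach_point_closed (convex_convexCombinations hconv)
    hK.isClosed h0
  -- The separating functional is positive on all combinations, in particular at `s`, a combination
  -- with weight 1 at `i`; its negative thus contradicts `h`.
  obtain ⟨i, s, hs, hsw⟩ := h (-(InnerProductSpace.toDual ℝ E).symm f)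
  choose a ha using hne
  have hmem := hf s ⟨(Pi.single i 1, Function.update a i s), ⟨single_mem_stdSimplex ℝ i, ?_⟩, ?_⟩
  · rw [inner_neg_right, real_inner_comm, InnerProductSpace.toDual_symm_apply] at hsw
    rw [map_zero] at hu
    linarith
  · intro j _
    rcases eq_or_ne j i with rfl | hj
    · simpa using hs
    · simpa [hj] using ha j
  · simp only
    rw [Finset.sum_eq_single i (fun j _ hj => by simp [hj]) (by simp)]
    simp

end Alternative

/-! ### Interval-valued functions and multiplier rules -/

theorem LocallyLipschitzIVF.fst_snd {n : ℕ} {f : EuclideanSpace ℝ (Fin n) → NonemptyInterval ℝ}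
    (hf : LocallyLipschitzIVF f) :
    LocallyLipschitz (fun u => (f u).fst) ∧ LocallyLipschitz (fun u => (f u).snd) := by
  have key : ∀ Q R : NonemptyInterval ℝ, |Q.fst - R.fst| ≤ intervalNorm (gHDiff Q R) ∧
      |Q.snd - R.snd| ≤ intervalNorm (gHDiff Q R) := by
    intro Q R
    simp only [intervalNorm, gHDiff]
    rcases le_total (Q.fst - R.fst) (Q.snd - R.snd) with h | h
    · rw [min_eq_left h, max_eq_right h]
      exact ⟨le_max_left _ _, le_max_right _ _⟩
    · rw [min_eq_right h, max_eq_left h]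
      exact ⟨le_max_right _ _, le_max_left _ _⟩
  constructor <;> intro z <;> obtain ⟨U, hU, L, hL, h⟩ := hf z <;>
    refine ⟨⟨L, hL.le⟩, U, hU, LipschitzOnWith.of_dist_le_mul fun x hx y hy => ?_⟩ <;>
    rw [Real.dist_eq, dist_eq_norm]
  · exact (key _ _).1.trans (h x hx y hy)
  · exact (key _ _).2.trans (h x hx y hy)

theorem LocallyLipschitzIVF.center_width {n : ℕ}
    {f : EuclideanSpace ℝ (Fin n) → NonemptyInterval ℝ} (hf : LocallyLipschitzIVF f) :
    LocallyLipschitz (fun u => center (f u)) ∧ LocallyLipschitz (fun u => width (f u)) := by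
  have h2 : LipschitzWith ‖(2 : ℝ)⁻¹‖₊ fun t : ℝ => t * 2⁻¹ :=
    LipschitzWith.of_dist_le_mul fun x y => by
      simp [Real.dist_eq, ← sub_mul, abs_mul, mul_comm]
  obtain ⟨h, h'⟩ := hf.fst_snd
  exact ⟨h2.locallyLipschitz.comp (h.add h'), h2.locallyLipschitz.comp (h'.sub h)⟩

/-- The Fritz John condition at a locally weak minimal solution. -/
theorem IsLocallyWeakMinimal.exists_fritzJohn {n m p : ℕ}
    {F : Fin m → EuclideanSpace ℝ (Fin n) → NonemptyInterval ℝ}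
    {g : Fin p → EuclideanSpace ℝ (Fin n) → ℝ}
    (hF : ∀ k, LocallyLipschitzIVF (F k)) (hg : ∀ j, LocallyLipschitz (g j))
    {z : EuclideanSpace ℝ (Fin n)} (hmin : IsLocallyWeakMinimal F (feasible g) z) :
    ∃ (lam : Fin m → ℝ) (μ : Fin p → ℝ)
      (u : Fin m → EuclideanSpace ℝ (Fin n)) (v : Fin p → EuclideanSpace ℝ (Fin n)),
      (∀ k, 0 ≤ lam k) ∧ (∀ j, 0 ≤ μ j) ∧ ∑ k, lam k + ∑ j, μ j = 1 ∧
      (∀ j, g j z ≠ 0 → μ j = 0) ∧ (∀ k, u k ∈ weakGrad (F k) z) ∧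
      (∀ j, v j ∈ clarkeGrad (g j) z) ∧ ∑ k, lam k • u k + ∑ j, μ j • v j = 0 := by
  classical
  obtain ⟨hz, U, hU, hno⟩ := hmin
  let φ : (Fin m ⊕ Fin m) ⊕ {j // g j z = 0} → EuclideanSpace ℝ (Fin n) → ℝ :=
    Sum.elim (Sum.elim (fun k u => center (F k u)) fun k u => width (F k u)) fun j => g j
  have hφ : ∀ i, LocallyLipschitz (φ i) := by
    rintro ((k | k) | j)
    exacts [(hF k).center_width.1, (hF k).center_width.2, hg j]
  obtain ⟨l, hl, a, ha, hla⟩ := exists_convexCombination_eq_zero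
    (fun i => convex_clarkeGrad (φ i) z) (fun i => isCompact_clarkeGrad (hφ i) z)
    (fun i => clarkeGrad_nonempty (hφ i) z) (by
      intro w
      by_contra! hcon
      -- The Clarke derivative is attained on the gradient, so it inherits strict negativity.
      have hdesc : ∀ i, ∀ᶠ t in 𝓝[>] (0 : ℝ), φ i (z + t • w) < φ i z := fun i => by
        obtain ⟨s, hs, hsw⟩ := exists_mem_clarkeGrad_inner_eq (hφ i) z w
        exact eventually_lt_of_clarkeDeriv_neg (hφ i) (hsw ▸ hcon i s hs)
      have hlim : Filter.Tendsto (fun t : ℝ => z + t • w) (𝓝[>] 0) (𝓝 z) := by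
        have hc : Continuous fun t : ℝ => z + t • w := by fun_prop
        simpa using (hc.tendsto 0).mono_left nhdsWithin_le_nhds
      have hinact : ∀ j, ∀ᶠ t in 𝓝[>] (0 : ℝ), g j z ≠ 0 → g j (z + t • w) < 0 := fun j => by
        by_cases hj : g j z = 0
        · exact Filter.Eventually.of_forall fun t h => absurd hj h
        · filter_upwards [(((hg j).continuous.tendsto z).comp hlim).eventually_lt_const
            ((hz j).lt_of_ne hj)] with t ht _ using ht
      obtain ⟨t, h1, h2, h3⟩ := ((Filter.eventually_all.2 hdesc).and
        ((Filter.eventually_all.2 hinact).and (hlim.eventually hU))).exists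
      refine hno ⟨z + t • w, ⟨fun j => ?_, h3⟩, fun k => ⟨h1 (.inl (.inl k)), h1 (.inl (.inr k))⟩⟩
      by_cases hj : g j z = 0
      · exact (h1 (.inr ⟨j, hj⟩)).le.trans_eq hj
      · exact (h2 j hj).le)
  -- Center and width terms merge into one weighted point of the convex hull.
  choose u hu hueq using fun k => (convex_convexHull ℝ
    (clarkeGrad (φ (.inl (.inl k))) z ∪ clarkeGrad (φ (.inl (.inr k))) z)).exists_mem_add_smul_eq
    (subset_convexHull ℝ _ (.inl (ha (.inl (.inl k)))))
    (subset_convexHull ℝ _ (.inr (ha (.inl (.inr k)))))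
    (hl.1 (.inl (.inl k))) (hl.1 (.inl (.inr k)))
  have hsum : ∀ {M : Type} [AddCommMonoid M] (f : {j // g j z = 0} → M),
      ∑ j, (if h : g j z = 0 then f ⟨j, h⟩ else 0) = ∑ j, f j := by
    intro M _ f
    rw [← Finset.sum_subset (Finset.subset_univ {j | g j z = 0})
      (fun j _ hj => dif_neg (by simpa using hj)),
      ← Finset.sum_subtype_eq_sum_filter, Finset.subtype_univ]
    exact Finset.sum_congr rfl fun j _ => dif_pos j.2
  -- Inactive constraints have multiplier zero but still need some gradient element.
  choose v₀ hv₀ using fun j => clarkeGrad_nonempty (hg j) z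
  refine ⟨fun k => l (.inl (.inl k)) + l (.inl (.inr k)),
    fun j => if h : g j z = 0 then l (.inr ⟨j, h⟩) else 0, u,
    fun j => if h : g j z = 0 then a (.inr ⟨j, h⟩) else v₀ j,
    fun k => add_nonneg (hl.1 _) (hl.1 _), fun j => ?_, ?_, fun j hj => dif_neg hj, hu,
    fun j => ?_, ?_⟩
  · dsimp only
    split_ifs
    exacts [hl.1 _, le_rfl]
  · rw [hsum fun j => l (.inr j), Finset.sum_add_distrib, ← hl.2, Fintype.sum_sum_type,
      Fintype.sum_sum_type]
  · dsimp only
    split_ifs with h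
    exacts [ha (.inr ⟨j, h⟩), hv₀ j]
  · have hμv : ∀ j, (if h : g j z = 0 then l (.inr ⟨j, h⟩) else 0) •
        (if h : g j z = 0 then a (.inr ⟨j, h⟩) else v₀ j) =
        if h : g j z = 0 then l (.inr ⟨j, h⟩) • a (.inr ⟨j, h⟩) else 0 := by
      intro j
      split_ifs <;> simp
    rw [Finset.sum_congr rfl fun j _ => hμv j, hsum fun j => l (.inr j) • a (.inr j), ← hla,
      Fintype.sum_sum_type, Fintype.sum_sum_type, ← Finset.sum_add_distrib]
    simp only [hueq]

/-- The Karush-Kuhn-Tucker condition at a locally weak minimal solution where the basic constraint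
qualification holds. -/
theorem IsLocallyWeakMinimal.exists_kkt {n m p : ℕ}
    {F : Fin m → EuclideanSpace ℝ (Fin n) → NonemptyInterval ℝ}
    {g : Fin p → EuclideanSpace ℝ (Fin n) → ℝ}
    (hF : ∀ k, LocallyLipschitzIVF (F k)) (hg : ∀ j, LocallyLipschitz (g j))
    {z : EuclideanSpace ℝ (Fin n)} (hmin : IsLocallyWeakMinimal F (feasible g) z)
    (hBCQ : BCQ g z) :
    ∃ (lam : Fin m → ℝ) (μ : Fin p → ℝ)
      (u : Fin m → EuclideanSpace ℝ (Fin n)) (v : Fin p → EuclideanSpace ℝ (Fin n)),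
      (∀ k, 0 ≤ lam k) ∧ ∑ k, lam k = 1 ∧ (∀ j, 0 ≤ μ j) ∧
      (∀ k, u k ∈ weakGrad (F k) z) ∧ (∀ j, v j ∈ clarkeGrad (g j) z) ∧
      ∑ k, lam k • u k + ∑ j, μ j • v j = 0 ∧ ∑ j, μ j * g j z = 0 := by
  obtain ⟨lam, μ, u, v, hlam, hμ, h1, hcs, hu, hv, h0⟩ := hmin.exists_fritzJohn hF hg
  have hpos : 0 < ∑ k, lam k := by
    -- If all objective weights vanished, `μ` would have sum 1 and violate BCQ.
    refine (Finset.sum_nonneg fun k _ => hlam k).lt_of_ne fun hs => hBCQ ?_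
    have hl0 : ∀ k, lam k = 0 := fun k =>
      (Finset.sum_eq_zero_iff_of_nonneg fun k _ => hlam k).1 hs.symm k (Finset.mem_univ k)
    refine ⟨μ, ?_, hμ, hcs, ?_⟩
    · rintro rfl
      simp [← hs] at h1
    · simp only [hl0, zero_smul, Finset.sum_const_zero, zero_add] at h0
      rw [← h0]
      exact Set.finsetSum_mem_finsetSum _ _ _ fun j _ => Set.smul_mem_smul_set (hv j)
  refine ⟨fun k => (∑ k, lam k)⁻¹ * lam k, fun j => (∑ k, lam k)⁻¹ * μ j, u, v,
    fun k => mul_nonneg (inv_nonneg.2 hpos.le) (hlam k), ?_,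
    fun j => mul_nonneg (inv_nonneg.2 hpos.le) (hμ j), hu, hv, ?_, ?_⟩
  · rw [← Finset.mul_sum, inv_mul_cancel₀ hpos.ne']
  · simp only [mul_smul, ← Finset.smul_sum, ← smul_add, h0, smul_zero]
  · refine Finset.sum_eq_zero fun j _ => ?_
    by_cases hj : g j z = 0
    · rw [hj, mul_zero]
    · simp [hcs j hj]

end MIOP

theorem theorem4p4 {n m p : ℕ}
    (F : Fin m → EuclideanSpace ℝ (Fin n) → NonemptyInterval ℝ)
    (g : Fin p → EuclideanSpace ℝ (Fin n) → ℝ)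
    (hF : ∀ k, MIOP.LocallyLipschitzIVF (F k))
    (hg : ∀ j, LocallyLipschitz (g j))
    (ubar : EuclideanSpace ℝ (Fin n))
    (hmin : MIOP.IsLocallyWeakMinimal F (MIOP.feasible g) ubar)
    (hBCQ : ∃ V ∈ 𝓝 ubar, ∀ u ∈ MIOP.feasible g ∩ V, MIOP.BCQ g u)
    (ε : ℕ → ℝ) (hε_pos : ∀ i, 0 < ε i) (hε : Filter.Tendsto ε Filter.atTop (𝓝 0))
    (x : ℕ → EuclideanSpace ℝ (Fin n)) (hxS : ∀ i, x i ∈ MIOP.feasible g)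
    (hx : Filter.Tendsto x Filter.atTop (𝓝 ubar)) :
    ∃ φ : ℕ → ℕ, StrictMono φ ∧
      ∀ i, ∃ y ∈ MIOP.feasible g,
        ‖x (φ i) - y‖ ≤ √(ε i) ∧
        ∃ (lam : Fin m → ℝ) (μ : Fin p → ℝ)
          (u : Fin m → EuclideanSpace ℝ (Fin n)) (v : Fin p → EuclideanSpace ℝ (Fin n)),
          (∀ k, 0 ≤ lam k) ∧ ∑ k, lam k = 1 ∧ (∀ j, 0 ≤ μ j) ∧
          (∀ k, u k ∈ MIOP.weakGrad (F k) y) ∧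
          (∀ j, v j ∈ MIOP.clarkeGrad (g j) y) ∧
          ‖∑ k, lam k • u k + ∑ j, μ j • v j‖ ≤ √(ε i) ∧
          ∑ j, μ j * g j y = 0 := by
  obtain ⟨V, hV, hVB⟩ := hBCQ
  obtain ⟨lam, μ, u, v, hlam, hsum, hμ, hu, hv, h0, hcs⟩ :=
    hmin.exists_kkt hF hg (hVB ubar ⟨hmin.1, mem_of_mem_nhds hV⟩)
  -- Each tolerance holds for all large indices, so one strictly increasing choice meets the `i`-th
  -- tolerance at step `i`.
  obtain ⟨φ, hφ, hle⟩ := Filter.extraction_forall_of_eventually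
    (P := fun i k => ‖x k - ubar‖ ≤ √(ε i)) fun i => by
      filter_upwards [hx.eventually (Metric.closedBall_mem_nhds ubar
        (Real.sqrt_pos.2 (hε_pos i)))] with k hk
      rwa [← dist_eq_norm]
  refine ⟨φ, hφ, fun i => ⟨ubar, hmin.1, hle i, lam, μ, u, v, hlam, hsum, hμ, hu, hv, ?_, hcs⟩⟩
  rw [h0, norm_zero]
  exact Real.sqrt_nonneg _
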